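/- Let $H$ be a complex Hilbert space with inner product $(\cdot\mid\cdot)$, linear in the first variable, let $T$ be a bounded linear operator on $H$, let $I$ be the identity operator on $H$, and let $\varepsilon\in[0,1)$. Let $\mathbb{B}(H)$ be the algebra of bounded linear operators on $H$ with the operator norm. For $x,y$ in a complex normed space, write $x\parallel^{\varepsilon}y$ if $\inf\{\|x+\mu y\|:\mu\in\mathbb{C}\}\le\varepsilon\|x\|$. Let $\delta_T:\mathbb{B}(H)\to\mathbb{B}(H)$, $\delta_T(S)=TS-ST$, be the inner derivation given by $T$, and let $\|\delta_T\|$ be its operator norm. Then the following statements are equivalent: (i) $T\parallel^{\varepsilon} I$ in $\mathbb{B}(H)$; (ii) $\sup\{\|T\xi-(T\xi\mid\xi)\xi\|:\ \xi\in H,\ \|\xi\|=1\}\le\varepsilon\|T\|$; (iii) $\sup\{\|T\xi\|^2-|(T\xi\mid\xi)|^2:\ \xi\in H,\ \|\xi\|=1\}\le\varepsilon^2\|T\|^2$; (iv) $\|\delta_T\|\le2\varepsilon\|T\|$. (If $H=\{0\}$, the suprema over the empty set are taken to be $0$.) -/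

import Mathlib

/-- `x` is `ε`-parallel to `y` in a complex normed space: `inf {‖x + μ y‖ : μ ∈ ℂ} ≤ ε ‖x‖`. -/
def ApproxParallel {V : Type*} [NormedAddCommGroup V] [NormedSpace ℂ V]
    (ε : ℝ) (x y : V) : Prop :=
  sInf {r : ℝ | ∃ μ : ℂ, r = ‖x + μ • y‖} ≤ ε * ‖x‖

/-- The inner derivation `S ↦ T S - S T`, as a bounded operator on the Banach space of bounded
operators on `H`; its norm is the operator norm. -/
noncomputable def innerDerivation {H : Type*} [NormedAddCommGroup H] [InnerProductSpace ℂ H]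
    (T : H →L[ℂ] H) : (H →L[ℂ] H) →L[ℂ] (H →L[ℂ] H) :=
  ContinuousLinearMap.mul ℂ (H →L[ℂ] H) T - (ContinuousLinearMap.mul ℂ (H →L[ℂ] H)).flip T

theorem innerDerivation_apply {H : Type*} [NormedAddCommGroup H] [InnerProductSpace ℂ H]
    (T S : H →L[ℂ] H) : innerDerivation T S = T * S - S * T := rfl

/-!
For a unit vector `ξ`, the deviation `‖T ξ - ⟪ξ, T ξ⟫ ξ‖` is the distance from `T ξ` to the line
`ℂ ξ`, and its square is `‖T ξ‖ ^ 2 - ‖⟪ξ, T ξ⟫‖ ^ 2`. All four quantities of the theorem are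
governed by its supremum `d` over the unit sphere: the distance from `T` to the scalars equals `d`
and `‖δ_T‖ = 2 d`.

That `d` is at most the distance to the scalars is clear, because deviations do not change when a
scalar operator is added to `T`. For the converse, translate `T` to an operator `S` that is closest
to `0` among its scalar translates. For `0 ≤ c < ‖S‖` the set `W` of all `⟪ξ, S ξ⟫` with `‖ξ‖ = 1`
and `c ≤ ‖S ξ‖` is convex, by a version of the Toeplitz–Hausdorff theorem with a quadratic
constraint. If `0` were not in the closure of `W`, a line would separate it from `W`, and moving `S`
a little by a scalar in the normal direction would decrease the norm. So there are unit vectors with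
`c ≤ ‖S ξ‖` and `⟪ξ, S ξ⟫` arbitrarily small, whence `c ≤ d`; now let `c` tend to `‖S‖`.

For the derivation, `‖δ_T‖ ≤ 2 ‖T + μ I‖` since `δ_T` is unchanged by scalar translations, while
`δ_T` maps the reflection in the line `ℂ ξ` to an operator whose value at `ξ` is twice
`T ξ - ⟪ξ, T ξ⟫ ξ`.
-/

open scoped InnerProductSpace ComplexConjugate

theorem exists_norm_eq_one_im_mul_eq_zero_re_mul_nonneg (z w : ℂ) :
    ∃ u : ℂ, ‖u‖ = 1 ∧ (u * z).im = 0 ∧ 0 ≤ (u * w).re := by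
  obtain ⟨u, hu, huz⟩ := RCLike.exists_norm_eq_mul_self z
  have him : (u * z).im = 0 := by rw [← huz]; exact Complex.ofReal_im _
  rcases le_total 0 (u * w).re with hre | hre
  · exact ⟨u, hu, him, hre⟩
  · exact ⟨-u, by rwa [norm_neg], by rw [neg_mul, Complex.neg_im, him, neg_zero],
      by rw [neg_mul, Complex.neg_re]; exact neg_nonneg.2 hre⟩

section SesquilinearForms

variable {V : Type*} [AddCommGroup V] [Module ℂ V]

theorem sesquilinear_apply_self_ofReal_smul_add (B : V →ₗ⋆[ℂ] V →ₗ[ℂ] ℂ) (s t : ℝ) (ξ η : V) :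
    B ((s : ℂ) • ξ + (t : ℂ) • η) ((s : ℂ) • ξ + (t : ℂ) • η) =
      (s ^ 2 : ℝ) * B ξ ξ + (t ^ 2 : ℝ) * B η η + (s * t : ℝ) * (B ξ η + B η ξ) := by
  simp only [map_add, map_smulₛₗ, LinearMap.add_apply, LinearMap.smul_apply, smul_eq_mul,
    Complex.conj_ofReal, RingHom.id_apply, Complex.ofReal_mul, Complex.ofReal_pow]
  ring

theorem exists_ne_zero_apply_self_eq_zero_of_im_cross_eq_zero {B Q : V →ₗ⋆[ℂ] V →ₗ[ℂ] ℂ}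
    {ξ η : V} {a b : ℝ} (ha : 0 < a) (hb : 0 < b) (hBξ : B ξ ξ = a) (hBη : B η η = -b)
    (hBim : (B ξ η + B η ξ).im = 0) (hQξ : 0 ≤ (Q ξ ξ).re) (hQη : 0 ≤ (Q η η).re)
    (hQre : 0 ≤ (Q ξ η + Q η ξ).re) :
    ∃ ζ : V, ζ ≠ 0 ∧ B ζ ζ = 0 ∧ 0 ≤ (Q ζ ζ).re := by
  obtain ⟨m, hm⟩ : ∃ m : ℝ, B ξ η + B η ξ = m := ⟨_, Complex.ext rfl hBim⟩
  obtain ⟨s, ⟨hs0, hs1⟩, hs⟩ : (0 : ℝ) ∈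
      (fun s : ℝ => s ^ 2 * a - (1 - s) ^ 2 * b + s * (1 - s) * m) '' Set.Icc 0 1 := by
    apply intermediate_value_Icc zero_le_one (by fun_prop)
    simp [ha.le, hb.le]
  refine ⟨(s : ℂ) • ξ + ((1 - s : ℝ) : ℂ) • η, fun hζ => ?_, ?_, ?_⟩
  · -- `B` takes values of opposite signs at `s • ξ` and `(1 - s) • η`
    have hB : s ^ 2 * a = -((1 - s) ^ 2 * b) := by
      have := congrArg (fun x => B x x) (eq_neg_of_add_eq_zero_left hζ)
      simp only [map_neg, map_smulₛₗ, LinearMap.neg_apply, LinearMap.smul_apply, smul_eq_mul,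
        Complex.conj_ofReal, RingHom.id_apply, hBξ, hBη] at this
      apply Complex.ofReal_injective
      push_cast at this ⊢
      linear_combination this
    have hsa : 0 ≤ s ^ 2 * a := by positivity
    have hsb : 0 ≤ (1 - s) ^ 2 * b := by positivity
    have hs_zero : s = 0 := by simpa [ha.ne'] using (show s ^ 2 * a = 0 by linarith)
    have hb_zero : (1 - s) ^ 2 * b = 0 := by linarith
    simp [hs_zero, hb.ne'] at hb_zero
  · rw [sesquilinear_apply_self_ofReal_smul_add, hBξ, hBη, hm]
    exact_mod_cast (by linear_combination hs :
      s ^ 2 * a + (1 - s) ^ 2 * -b + s * (1 - s) * m = 0)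
  · rw [sesquilinear_apply_self_ofReal_smul_add, Complex.add_re, Complex.add_re,
      Complex.re_ofReal_mul, Complex.re_ofReal_mul, Complex.re_ofReal_mul]
    exact add_nonneg (add_nonneg (mul_nonneg (sq_nonneg s) hQξ) (mul_nonneg (sq_nonneg _) hQη))
      (mul_nonneg (mul_nonneg hs0 (sub_nonneg.2 hs1)) hQre)

theorem exists_ne_zero_apply_self_eq_zero {B Q : V →ₗ⋆[ℂ] V →ₗ[ℂ] ℂ} {ξ η : V} {a b : ℝ}
    (ha : 0 < a) (hb : 0 < b) (hBξ : B ξ ξ = a) (hBη : B η η = -b)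
    (hQξ : 0 ≤ (Q ξ ξ).re) (hQη : 0 ≤ (Q η η).re) :
    ∃ ζ : V, ζ ≠ 0 ∧ B ζ ζ = 0 ∧ 0 ≤ (Q ζ ζ).re := by
  -- With `u • η` for `η`, the cross term of `B` is real and that of `Q` has nonnegative real part.
  obtain ⟨u, hu, huB, huQ⟩ := exists_norm_eq_one_im_mul_eq_zero_re_mul_nonneg
    (B ξ η - conj (B η ξ)) (Q ξ η + conj (Q η ξ))
  have hself (C : V →ₗ⋆[ℂ] V →ₗ[ℂ] ℂ) : C (u • η) (u • η) = C η η := by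
    have huu : conj u * u = 1 := by rw [Complex.conj_mul', hu]; norm_num
    rw [map_smul, map_smulₛₗ, LinearMap.smul_apply, smul_smul, mul_comm, huu, one_smul]
  have hcross (C : V →ₗ⋆[ℂ] V →ₗ[ℂ] ℂ) :
      C ξ (u • η) + C (u • η) ξ = u * C ξ η + conj u * C η ξ := by
    simp
  refine exists_ne_zero_apply_self_eq_zero_of_im_cross_eq_zero (η := u • η) ha hb hBξ
    ((hself B).trans hBη) ?_ hQξ (by rwa [hself]) ?_
  · rw [hcross]
    simp only [Complex.mul_im, Complex.add_im, Complex.sub_im, Complex.sub_re, Complex.conj_re,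
      Complex.conj_im] at huB ⊢
    linarith
  · rw [hcross]
    simp only [Complex.mul_re, Complex.add_re, Complex.add_im, Complex.conj_re,
      Complex.conj_im] at huQ ⊢
    linarith

end SesquilinearForms

section NumericalRange

variable {H : Type*} [NormedAddCommGroup H] [InnerProductSpace ℂ H]

theorem exists_norm_eq_one_apply_self_of_ne_zero {B Q : H →ₗ⋆[ℂ] H →ₗ[ℂ] ℂ} {ζ : H} {z : ℂ}
    (hζ : ζ ≠ 0) (hB : B ζ ζ = z * ⟪ζ, ζ⟫_ℂ) (hQ : 0 ≤ (Q ζ ζ).re) :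
    ∃ ξ : H, ‖ξ‖ = 1 ∧ 0 ≤ (Q ξ ξ).re ∧ B ξ ξ = z := by
  have hself (C : H →ₗ⋆[ℂ] H →ₗ[ℂ] ℂ) :
      C (((‖ζ‖⁻¹ : ℝ) : ℂ) • ζ) (((‖ζ‖⁻¹ : ℝ) : ℂ) • ζ) = (((‖ζ‖⁻¹) ^ 2 : ℝ) : ℂ) * C ζ ζ := by
    simpa using sesquilinear_apply_self_ofReal_smul_add C ‖ζ‖⁻¹ 0 ζ 0
  have hnorm : (‖ζ‖ : ℂ) ≠ 0 := by simpa using hζ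
  refine ⟨((‖ζ‖⁻¹ : ℝ) : ℂ) • ζ, by simp [norm_smul, hζ], ?_, ?_⟩
  · rw [hself, Complex.re_ofReal_mul]
    positivity
  · rw [hself, hB, inner_self_eq_norm_sq_to_K]
    push_cast
    field_simp
    exact mul_comm _ _

/-- Without the constraint `Q`, this is the Toeplitz–Hausdorff theorem. -/
theorem convex_setOf_apply_self_of_nonneg (B Q : H →ₗ⋆[ℂ] H →ₗ[ℂ] ℂ) :
    Convex ℝ {z : ℂ | ∃ ξ : H, ‖ξ‖ = 1 ∧ 0 ≤ (Q ξ ξ).re ∧ B ξ ξ = z} := by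
  rw [convex_iff_pairwise_pos]
  rintro _ ⟨ξ, hξ, hQξ, rfl⟩ _ ⟨η, hη, hQη, rfl⟩ hne a b ha hb hab
  set p := B ξ ξ
  set q := B η η
  set z : ℂ := a • p + b • q with hz
  have hpq : p - q ≠ 0 := sub_ne_zero.2 hne
  have hab' : (a : ℂ) + b = 1 := by exact_mod_cast hab
  have hpz : p - z = b * (p - q) := by
    rw [hz, Complex.real_smul, Complex.real_smul]
    linear_combination -p * hab'
  have hqz : q - z = -a * (p - q) := by
    rw [hz, Complex.real_smul, Complex.real_smul]
    linear_combination -q * hab'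
  -- The normalization puts the values at `ξ` and `η` on the two sides of `0` on the real line.
  let C : H →ₗ⋆[ℂ] H →ₗ[ℂ] ℂ := (p - q)⁻¹ • (B - z • innerₛₗ ℂ)
  have hC (ζ : H) : C ζ ζ = (p - q)⁻¹ * (B ζ ζ - z * ⟪ζ, ζ⟫_ℂ) := rfl
  obtain ⟨ζ, hζ, hCζ, hQζ⟩ := exists_ne_zero_apply_self_eq_zero (B := C) hb ha
    (by rw [hC, inner_self_eq_one_of_norm_eq_one hξ, mul_one, hpz, mul_comm, mul_assoc,
      mul_inv_cancel₀ hpq, mul_one])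
    (by rw [hC, inner_self_eq_one_of_norm_eq_one hη, mul_one, hqz, mul_comm, mul_assoc,
      mul_inv_cancel₀ hpq, mul_one]) hQξ hQη
  refine exists_norm_eq_one_apply_self_of_ne_zero hζ ?_ hQζ
  rw [hC, mul_eq_zero, or_iff_right (inv_ne_zero hpq), sub_eq_zero] at hCζ
  exact hCζ

/-- The part of the numerical range of `S` that comes from the unit vectors `ξ` with `c ≤ ‖S ξ‖`. -/
def upperNumericalRange (S : H →L[ℂ] H) (c : ℝ) : Set ℂ :=
  {z | ∃ ξ : H, ‖ξ‖ = 1 ∧ c ≤ ‖S ξ‖ ∧ ⟪ξ, S ξ⟫_ℂ = z}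

theorem convex_upperNumericalRange (S : H →L[ℂ] H) {c : ℝ} (hc : 0 ≤ c) :
    Convex ℝ (upperNumericalRange S c) := by
  let S' : H →ₗ[ℂ] H := S
  let Q : H →ₗ⋆[ℂ] H →ₗ[ℂ] ℂ :=
    ((innerₛₗ ℂ).comp S').compl₂ S' - ((c ^ 2 : ℝ) : ℂ) • innerₛₗ ℂ
  have hQ {ξ : H} (hξ : ‖ξ‖ = 1) : 0 ≤ (Q ξ ξ).re ↔ c ≤ ‖S ξ‖ := by
    have hQξ : Q ξ ξ = ((‖S ξ‖ ^ 2 - c ^ 2 : ℝ) : ℂ) := by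
      change ⟪S ξ, S ξ⟫_ℂ - ((c ^ 2 : ℝ) : ℂ) * ⟪ξ, ξ⟫_ℂ = _
      rw [inner_self_eq_norm_sq_to_K, inner_self_eq_one_of_norm_eq_one hξ]
      simp
    rw [hQξ, Complex.ofReal_re, sub_nonneg, sq_le_sq₀ hc (norm_nonneg _)]
  convert convex_setOf_apply_self_of_nonneg ((innerₛₗ ℂ).compl₂ S') Q using 1
  ext z
  exact exists_congr fun ξ => and_congr_right fun hξ => and_congr_left fun _ => (hQ hξ).symm

end NumericalRange

section Deviation

variable {𝕜 H : Type*} [RCLike 𝕜] [NormedAddCommGroup H] [InnerProductSpace 𝕜 H]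

theorem norm_sub_inner_smul_sq {ξ : H} (hξ : ‖ξ‖ = 1) (x : H) :
    ‖x - ⟪ξ, x⟫_𝕜 • ξ‖ ^ 2 = ‖x‖ ^ 2 - ‖⟪ξ, x⟫_𝕜‖ ^ 2 := by
  rw [@norm_sub_sq 𝕜, inner_smul_right, inner_mul_symm_re_eq_norm, norm_mul, norm_inner_symm x ξ,
    norm_smul, hξ]
  ring

/-- The supremum, over all unit vectors `ξ`, of the distance from `T ξ` to the line spanned by `ξ`.
It is `0` on the trivial space, where there are no unit vectors. -/
noncomputable def maxDeviation (T : H →L[𝕜] H) : ℝ :=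
  sSup {r : ℝ | ∃ ξ : H, ‖ξ‖ = 1 ∧ r = ‖T ξ - ⟪ξ, T ξ⟫_𝕜 • ξ‖}

theorem norm_sub_inner_smul_le_opNorm (T : H →L[𝕜] H) {ξ : H} (hξ : ‖ξ‖ = 1) :
    ‖T ξ - ⟪ξ, T ξ⟫_𝕜 • ξ‖ ≤ ‖T‖ := by
  have hle : ‖T ξ - ⟪ξ, T ξ⟫_𝕜 • ξ‖ ^ 2 ≤ ‖T ξ‖ ^ 2 := by
    rw [norm_sub_inner_smul_sq hξ]
    exact sub_le_self _ (sq_nonneg _)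
  exact (le_of_sq_le_sq hle (norm_nonneg _)).trans (T.unit_le_opNorm ξ hξ.le)

theorem maxDeviation_nonneg (T : H →L[𝕜] H) : 0 ≤ maxDeviation T :=
  Real.sSup_nonneg fun _ ⟨_, _, hr⟩ => hr ▸ norm_nonneg _

theorem norm_sub_inner_smul_le_maxDeviation (T : H →L[𝕜] H) {ξ : H} (hξ : ‖ξ‖ = 1) :
    ‖T ξ - ⟪ξ, T ξ⟫_𝕜 • ξ‖ ≤ maxDeviation T :=
  le_csSup ⟨‖T‖, fun _ ⟨_, hη, hr⟩ => hr ▸ norm_sub_inner_smul_le_opNorm T hη⟩ ⟨ξ, hξ, rfl⟩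

theorem maxDeviation_le {T : H →L[𝕜] H} {M : ℝ} (hM : 0 ≤ M)
    (h : ∀ ξ : H, ‖ξ‖ = 1 → ‖T ξ - ⟪ξ, T ξ⟫_𝕜 • ξ‖ ≤ M) : maxDeviation T ≤ M :=
  Real.sSup_le (fun _ ⟨ξ, hξ, hr⟩ => hr ▸ h ξ hξ) hM

theorem maxDeviation_le_opNorm (T : H →L[𝕜] H) : maxDeviation T ≤ ‖T‖ :=
  maxDeviation_le (norm_nonneg T) fun _ => norm_sub_inner_smul_le_opNorm T

theorem maxDeviation_add_smul_id (T : H →L[𝕜] H) (μ : 𝕜) :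
    maxDeviation (T + μ • ContinuousLinearMap.id 𝕜 H) = maxDeviation T := by
  have hdev {ξ : H} (hξ : ‖ξ‖ = 1) :
      (T + μ • ContinuousLinearMap.id 𝕜 H) ξ -
        ⟪ξ, (T + μ • ContinuousLinearMap.id 𝕜 H) ξ⟫_𝕜 • ξ = T ξ - ⟪ξ, T ξ⟫_𝕜 • ξ := by
    simp [inner_add_right, inner_smul_right, hξ, add_smul]
  refine congrArg sSup (Set.ext fun r => exists_congr fun ξ => and_congr_right fun hξ => ?_)
  rw [hdev hξ]

theorem sSup_norm_sq_sub_norm_inner_sq_eq (T : H →L[𝕜] H) :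
    sSup {r : ℝ | ∃ ξ : H, ‖ξ‖ = 1 ∧ r = ‖T ξ‖ ^ 2 - ‖⟪ξ, T ξ⟫_𝕜‖ ^ 2} =
      maxDeviation T ^ 2 := by
  have hbound {ξ : H} (hξ : ‖ξ‖ = 1) : ‖T ξ‖ ^ 2 - ‖⟪ξ, T ξ⟫_𝕜‖ ^ 2 ≤ maxDeviation T ^ 2 := by
    rw [← norm_sub_inner_smul_sq hξ]
    gcongr
    exact norm_sub_inner_smul_le_maxDeviation T hξ
  apply le_antisymm
  · exact Real.sSup_le (fun _ ⟨_, hξ, hr⟩ => hr ▸ hbound hξ) (sq_nonneg _)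
  · have hnonneg : 0 ≤ sSup {r : ℝ | ∃ ξ : H, ‖ξ‖ = 1 ∧ r = ‖T ξ‖ ^ 2 - ‖⟪ξ, T ξ⟫_𝕜‖ ^ 2} :=
      Real.sSup_nonneg fun _ ⟨_, hξ, hr⟩ => hr ▸ norm_sub_inner_smul_sq (𝕜 := 𝕜) hξ _ ▸ sq_nonneg _
    rw [← Real.le_sqrt (maxDeviation_nonneg T) hnonneg]
    refine maxDeviation_le (Real.sqrt_nonneg _) fun ξ hξ => Real.le_sqrt_of_sq_le ?_
    rw [norm_sub_inner_smul_sq hξ]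
    exact le_csSup ⟨_, fun _ ⟨_, hη, hr⟩ => hr ▸ hbound hη⟩ ⟨ξ, hξ, rfl⟩

theorem norm_sub_ofReal_mul_smul_sq {ξ : H} (hξ : ‖ξ‖ = 1) (x : H) (s : ℝ) (w : 𝕜) :
    ‖x - ((s : 𝕜) * w) • ξ‖ ^ 2 =
      ‖x‖ ^ 2 - 2 * (s * RCLike.re (conj w * ⟪ξ, x⟫_𝕜)) + (s * ‖w‖) ^ 2 := by
  rw [@norm_sub_sq 𝕜, inner_re_symm, inner_smul_left, map_mul (starRingEnd 𝕜), RCLike.conj_ofReal,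
    mul_assoc, RCLike.re_ofReal_mul, norm_smul, norm_mul, RCLike.norm_ofReal, hξ, mul_one, mul_pow,
    sq_abs, mul_pow]

theorem exists_norm_sub_smul_id_lt {S : H →L[𝕜] H} {c δ : ℝ} {w : 𝕜} (hc : 0 ≤ c)
    (hcS : c < ‖S‖) (hδ : 0 < δ)
    (h : ∀ ξ : H, ‖ξ‖ = 1 → c ≤ ‖S ξ‖ → δ ≤ RCLike.re (conj w * ⟪ξ, S ξ⟫_𝕜)) :
    ∃ s : ℝ, ‖S - ((s : 𝕜) * w) • ContinuousLinearMap.id 𝕜 H‖ < ‖S‖ := by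
  have hS : 0 < ‖S‖ := hc.trans_lt hcS
  obtain ⟨s, hs0, hsδ, hsc⟩ : ∃ s : ℝ, 0 < s ∧ s * ‖w‖ ^ 2 < 2 * δ ∧ c + s * ‖w‖ < ‖S‖ := by
    have hsmall : ∀ᶠ s : ℝ in nhds 0, s * ‖w‖ ^ 2 < 2 * δ ∧ c + s * ‖w‖ < ‖S‖ :=
      (ContinuousAt.eventually_lt (by fun_prop) (by fun_prop) (by simpa using hδ)).and
        (ContinuousAt.eventually_lt (by fun_prop) (by fun_prop) (by simpa using hcS))
    obtain ⟨s, hs, hs0⟩ :=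
      ((hsmall.filter_mono nhdsWithin_le_nhds).and (self_mem_nhdsWithin (s := Set.Ioi 0))).exists
    exact ⟨s, hs0, hs⟩
  refine ⟨s, lt_of_le_of_lt (b := max √(‖S‖ ^ 2 - s * (2 * δ - s * ‖w‖ ^ 2)) (c + s * ‖w‖))
    (ContinuousLinearMap.opNorm_le_of_unit_norm (le_max_of_le_left (Real.sqrt_nonneg _))
      fun ξ hξ => ?_) (max_lt ?_ hsc)⟩
  · have happly : (S - ((s : 𝕜) * w) • ContinuousLinearMap.id 𝕜 H) ξ =
        S ξ - ((s : 𝕜) * w) • ξ := rfl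
    rw [happly]
    rcases le_or_gt c ‖S ξ‖ with hcξ | hcξ
    · refine le_max_of_le_left (Real.le_sqrt_of_sq_le ?_)
      have hSξ : ‖S ξ‖ ^ 2 ≤ ‖S‖ ^ 2 := by gcongr; exact S.unit_le_opNorm ξ hξ.le
      have hδξ : s * δ ≤ s * RCLike.re (conj w * ⟪ξ, S ξ⟫_𝕜) := by gcongr; exact h ξ hξ hcξ
      rw [norm_sub_ofReal_mul_smul_sq hξ]
      linarith
    · refine le_max_of_le_right ((norm_sub_le _ _).trans ?_)
      rw [norm_smul, norm_mul, RCLike.norm_of_nonneg hs0.le, hξ, mul_one]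
      gcongr
  · rw [Real.sqrt_lt' hS]
    exact sub_lt_self _ (mul_pos hs0 (sub_pos.2 hsδ))

end Deviation

theorem exists_forall_norm_add_smul_le {𝕜 E : Type*} [NontriviallyNormedField 𝕜] [ProperSpace 𝕜]
    [NormedAddCommGroup E] [NormedSpace 𝕜 E] (x y : E) :
    ∃ μ₀ : 𝕜, ∀ μ : 𝕜, ‖x + μ₀ • y‖ ≤ ‖x + μ • y‖ := by
  rcases eq_or_ne y 0 with rfl | hy
  · exact ⟨0, fun μ => by simp⟩
  refine Continuous.exists_forall_le (by fun_prop) (Filter.tendsto_atTop_mono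
    (f := fun μ : 𝕜 => ‖μ‖ * ‖y‖ - ‖x‖) (fun μ => ?_) ?_)
  · rw [← norm_smul, add_comm x]
    exact norm_sub_le_norm_add _ _
  · exact Filter.tendsto_atTop_add_const_right _ _
      ((tendsto_norm_cocompact_atTop (E := 𝕜)).atTop_mul_const (norm_pos_iff.2 hy))

section DistanceToScalars

variable {H : Type*} [NormedAddCommGroup H] [InnerProductSpace ℂ H]

theorem zero_mem_closure_upperNumericalRange {S : H →L[ℂ] H} {c : ℝ}
    (hS : ∀ μ : ℂ, ‖S‖ ≤ ‖S + μ • ContinuousLinearMap.id ℂ H‖) (hc : 0 ≤ c) (hcS : c < ‖S‖) :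
    (0 : ℂ) ∈ closure (upperNumericalRange S c) := by
  by_contra h0
  obtain ⟨f, δ, hδ, hf⟩ := RCLike.geometric_hahn_banach_point_closed (𝕜 := ℂ)
    (convex_upperNumericalRange S hc).closure isClosed_closure h0
  rw [map_zero, RCLike.zero_re] at hδ
  obtain ⟨s, hs⟩ := exists_norm_sub_smul_id_lt (w := conj (f 1)) hc hcS hδ fun ξ hξ hcξ => by
    have hfξ : f ⟪ξ, S ξ⟫_ℂ = conj (conj (f 1)) * ⟪ξ, S ξ⟫_ℂ := by
      rw [Complex.conj_conj, mul_comm, ← smul_eq_mul, ← map_smul, smul_eq_mul, mul_one]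
    rw [← hfξ]
    exact (hf _ (subset_closure ⟨ξ, hξ, hcξ, rfl⟩)).le
  rw [sub_eq_add_neg, ← neg_smul] at hs
  exact (hS _).not_gt hs

theorem opNorm_le_maxDeviation {S : H →L[ℂ] H}
    (hS : ∀ μ : ℂ, ‖S‖ ≤ ‖S + μ • ContinuousLinearMap.id ℂ H‖) : ‖S‖ ≤ maxDeviation S := by
  refine le_of_forall_lt_imp_le_of_dense fun c hcS => ?_
  rcases le_total c 0 with hc | hc
  · exact hc.trans (maxDeviation_nonneg S)
  have hsub : closure (upperNumericalRange S c) ⊆ {z | c ^ 2 ≤ maxDeviation S ^ 2 + ‖z‖ ^ 2} := by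
    refine closure_minimal ?_ (isClosed_le continuous_const (by fun_prop))
    rintro _ ⟨ξ, hξ, hcξ, rfl⟩
    calc c ^ 2 ≤ ‖S ξ‖ ^ 2 := by gcongr
      _ = ‖S ξ - ⟪ξ, S ξ⟫_ℂ • ξ‖ ^ 2 + ‖⟪ξ, S ξ⟫_ℂ‖ ^ 2 := by
        rw [norm_sub_inner_smul_sq hξ, sub_add_cancel]
      _ ≤ maxDeviation S ^ 2 + ‖⟪ξ, S ξ⟫_ℂ‖ ^ 2 := by
        gcongr
        exact norm_sub_inner_smul_le_maxDeviation S hξ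
  have hc_sq : c ^ 2 ≤ maxDeviation S ^ 2 := by
    simpa using hsub (zero_mem_closure_upperNumericalRange hS hc hcS)
  exact le_of_sq_le_sq hc_sq (maxDeviation_nonneg S)

theorem exists_norm_add_smul_id_le_maxDeviation (T : H →L[ℂ] H) :
    ∃ μ : ℂ, ‖T + μ • ContinuousLinearMap.id ℂ H‖ ≤ maxDeviation T := by
  obtain ⟨μ, hμ⟩ := exists_forall_norm_add_smul_le (𝕜 := ℂ) T (ContinuousLinearMap.id ℂ H)
  refine ⟨μ, ?_⟩
  rw [← maxDeviation_add_smul_id T μ]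
  refine opNorm_le_maxDeviation fun ν => ?_
  rw [add_assoc, ← add_smul]
  exact hμ (μ + ν)

theorem sInf_norm_add_smul_id_eq_maxDeviation (T : H →L[ℂ] H) :
    sInf {r : ℝ | ∃ μ : ℂ, r = ‖T + μ • ContinuousLinearMap.id ℂ H‖} = maxDeviation T := by
  obtain ⟨μ, hμ⟩ := exists_norm_add_smul_id_le_maxDeviation T
  have hlower (ν : ℂ) : maxDeviation T ≤ ‖T + ν • ContinuousLinearMap.id ℂ H‖ :=
    (maxDeviation_add_smul_id T ν).symm.trans_le (maxDeviation_le_opNorm _)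
  exact IsLeast.csInf_eq ⟨⟨μ, (hlower μ).antisymm hμ⟩, fun _ ⟨ν, hr⟩ => hr ▸ hlower ν⟩

end DistanceToScalars

section InnerDerivation

variable {H : Type*} [NormedAddCommGroup H] [InnerProductSpace ℂ H]

theorem innerDerivation_add_smul_id (T : H →L[ℂ] H) (μ : ℂ) :
    innerDerivation (T + μ • ContinuousLinearMap.id ℂ H) = innerDerivation T := by
  ext S x
  simp [innerDerivation_apply]

theorem norm_innerDerivation_le (T : H →L[ℂ] H) : ‖innerDerivation T‖ ≤ 2 * ‖T‖ := by
  refine ContinuousLinearMap.opNorm_le_bound _ (by positivity) fun S => ?_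
  calc ‖T * S - S * T‖ ≤ ‖T * S‖ + ‖S * T‖ := norm_sub_le _ _
    _ ≤ ‖T‖ * ‖S‖ + ‖S‖ * ‖T‖ := add_le_add (norm_mul_le _ _) (norm_mul_le _ _)
    _ = 2 * ‖T‖ * ‖S‖ := by ring

theorem two_mul_norm_sub_inner_smul_le (T : H →L[ℂ] H) {ξ : H} (hξ : ‖ξ‖ = 1) :
    2 * ‖T ξ - ⟪ξ, T ξ⟫_ℂ • ξ‖ ≤ ‖innerDerivation T‖ := by
  let V : H →L[ℂ] H := ((ℂ ∙ ξ).reflection.toContinuousLinearEquiv : H →L[ℂ] H)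
  have hVnorm : ‖V‖ ≤ 1 := V.opNorm_le_bound zero_le_one fun x => by
    rw [one_mul]
    exact ((ℂ ∙ ξ).reflection.norm_map x).le
  have hVξ : V ξ = ξ :=
    Submodule.reflection_mem_subspace_eq_self (Submodule.mem_span_singleton_self ξ)
  have hVT : V (T ξ) = (2 : ℂ) • ⟪ξ, T ξ⟫_ℂ • ξ - T ξ := by
    change (ℂ ∙ ξ).reflection (T ξ) = _
    rw [Submodule.reflection_apply, Submodule.starProjection_unit_singleton ℂ hξ, two_smul,
      two_smul]
  have hδ : innerDerivation T V ξ = (2 : ℂ) • (T ξ - ⟪ξ, T ξ⟫_ℂ • ξ) := by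
    change T (V ξ) - V (T ξ) = _
    rw [hVξ, hVT, smul_sub, two_smul ℂ (T ξ)]
    abel
  calc 2 * ‖T ξ - ⟪ξ, T ξ⟫_ℂ • ξ‖ = ‖innerDerivation T V ξ‖ := by
        rw [hδ, norm_smul, Complex.norm_ofNat]
    _ ≤ ‖innerDerivation T V‖ := (innerDerivation T V).unit_le_opNorm ξ hξ.le
    _ ≤ ‖innerDerivation T‖ := (innerDerivation T).unit_le_opNorm V hVnorm

theorem norm_innerDerivation_eq (T : H →L[ℂ] H) :
    ‖innerDerivation T‖ = 2 * maxDeviation T := by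
  apply le_antisymm
  · obtain ⟨μ, hμ⟩ := exists_norm_add_smul_id_le_maxDeviation T
    calc ‖innerDerivation T‖ = ‖innerDerivation (T + μ • ContinuousLinearMap.id ℂ H)‖ := by
          rw [innerDerivation_add_smul_id]
      _ ≤ 2 * ‖T + μ • ContinuousLinearMap.id ℂ H‖ := norm_innerDerivation_le _
      _ ≤ 2 * maxDeviation T := by gcongr
  · rw [← le_div_iff₀' two_pos]
    refine maxDeviation_le (by positivity) fun ξ hξ => ?_
    rw [le_div_iff₀' two_pos]
    exact two_mul_norm_sub_inner_smul_le T hξ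

end InnerDerivation

theorem mainTheorem4_general {H : Type*} [NormedAddCommGroup H] [InnerProductSpace ℂ H]
    (T : H →L[ℂ] H) {ε : ℝ} (hε : 0 ≤ ε) :
    List.TFAE [
      ApproxParallel ε T (ContinuousLinearMap.id ℂ H),
      sSup {r : ℝ | ∃ ξ : H, ‖ξ‖ = 1 ∧ r = ‖T ξ - ⟪ξ, T ξ⟫_ℂ • ξ‖} ≤ ε * ‖T‖,
      sSup {r : ℝ | ∃ ξ : H, ‖ξ‖ = 1 ∧ r = ‖T ξ‖ ^ 2 - ‖⟪ξ, T ξ⟫_ℂ‖ ^ 2} ≤ ε ^ 2 * ‖T‖ ^ 2,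
      ‖innerDerivation T‖ ≤ 2 * ε * ‖T‖] := by
  rw [ApproxParallel, sInf_norm_add_smul_id_eq_maxDeviation, ← maxDeviation,
    sSup_norm_sq_sub_norm_inner_sq_eq, ← mul_pow,
    sq_le_sq₀ (maxDeviation_nonneg T) (by positivity), norm_innerDerivation_eq, mul_assoc,
    mul_le_mul_iff_right₀ two_pos]
  tfae_finish

theorem mainTheorem4 {H : Type*} [NormedAddCommGroup H] [InnerProductSpace ℂ H] [CompleteSpace H]
    (T : H →L[ℂ] H) (ε : ℝ) (hε : ε ∈ Set.Ico (0 : ℝ) 1) :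
    List.TFAE [
      ApproxParallel ε T (ContinuousLinearMap.id ℂ H),
      sSup {r : ℝ | ∃ ξ : H, ‖ξ‖ = 1 ∧ r = ‖T ξ - (inner ℂ ξ (T ξ) : ℂ) • ξ‖} ≤ ε * ‖T‖,
      sSup {r : ℝ | ∃ ξ : H, ‖ξ‖ = 1 ∧ r = ‖T ξ‖ ^ 2 - ‖(inner ℂ ξ (T ξ) : ℂ)‖ ^ 2}
        ≤ ε ^ 2 * ‖T‖ ^ 2,
      ‖innerDerivation T‖ ≤ 2 * ε * ‖T‖] := by
  exact mainTheorem4_general T hε.1
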